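/- Distributive lattices are bounded (with $0=\bot$ and $1=\top$, preserved by homomorphisms), and $DL(n)$ denotes the free distributive lattice on $n$ generators. The cube category $\Box$ has objects $n\in\mathbb N$; a morphism $m\to n$ is an $n$-tuple of elements of $DL(m)$, and composition is substitution (so $\Box$ is the opposite of the category of free finitely generated distributive lattices). Cubical sets are presheaves of sets on $\Box$, and simplicial sets are presheaves of sets on the simplex category $\Delta$. For a distributive lattice $D$ in a topos $\mathcal X$ of sheaves of sets on a site, let $S_D:\Box\to\mathcal X$ be the functor $n\mapsto D^n$ on which tuples of lattice polynomials act by evaluation. $D$ is called flat if $S_D$ is filtering in the internal sense of $\mathcal X$. For $\mathcal X=\mathrm{Set}$ this means: some $D^n$ is inhabited; any $y\in D^c$ and $z\in D^d$ are the images under some $\alpha:b\to c$, $\beta:b\to d$ of one $w\in D^b$; and if $\alpha,\beta:c\to d$ satisfy $\alpha(y)=\beta(y)$ for some $y\in D^c$, then there are $\gamma:b\to c$ and $z\in D^b$ with $\alpha\circ\gamma=\beta\circ\gamma$ and $\gamma(z)=y$. In a general $\mathcal X$ the existence statements are required locally, i.e. after restriction along a covering sieve. A linear order with distinct endpoints in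 $\mathcal X$ is a partially ordered object with a least element $0$ and a greatest element $1$ for which $x\le y\,\vee\,y\le x$ and $0\neq 1$ hold in the internal sense. **Proposition.** 1. Every linearly ordered set $D$ with least element $0$ and greatest element $1$, $0\ne1$, is a flat distributive lattice (with $\wedge=\min$, $\vee=\max$). More generally, every linear order with distinct endpoints in a topos of sheaves on a site is the underlying ordered object of a distributive lattice in that topos, and this distributive lattice is flat. 2. The simplicial set $\Delta[1]$, with the pointwise order on monotone maps $[n]\to[1]$, is a linear order with distinct endpoints in the topos $\widehat\Delta$ of simplicial sets, and there is a geometric morphism $p:\widehat\Delta\to\widehat\Box$ from simplicial sets to cubical sets, i.e. an adjunction $p^*\dashv p_*$ with $p_*:\widehat\Delta\to\widehat\Box$ and $p^*:\widehat\Box\to\widehat\Delta$ preserving finite limits, whose inverse image restricts along the Yoneda embedding $y:\Box\to\widehat\Box$ to $p^*\circ y\cong S_{\Delta[1]}$; that is, $p^*(y(n))\cong\Delta[1]^n$ naturally in $n\in\Box$. -/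

import Mathlib

open CategoryTheory Opposite

universe t w v u

noncomputable section

/-! ### Free bounded distributive lattices -/

/-- Terms in the language `⊥, ⊤, ⊓, ⊔` of bounded lattices, with variables in `X`. -/
inductive DLTerm (X : Type u) : Type u where
  | var (x : X) : DLTerm X
  | bot : DLTerm X
  | top : DLTerm X
  | inf (s t : DLTerm X) : DLTerm X
  | sup (s t : DLTerm X) : DLTerm X

namespace DLTerm

/-- Provable inequality between terms in the theory of bounded distributive lattices. -/
inductive Le {X : Type u} : DLTerm X → DLTerm X → Prop where
  | refl (a : DLTerm X) : Le a a
  | trans {a b c : DLTerm X} : Le a b → Le b c → Le a c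
  | bot_le (a : DLTerm X) : Le bot a
  | le_top (a : DLTerm X) : Le a top
  | inf_le_left (a b : DLTerm X) : Le (inf a b) a
  | inf_le_right (a b : DLTerm X) : Le (inf a b) b
  | le_inf {a b c : DLTerm X} : Le a b → Le a c → Le a (inf b c)
  | le_sup_left (a b : DLTerm X) : Le a (sup a b)
  | le_sup_right (a b : DLTerm X) : Le b (sup a b)
  | sup_le {a b c : DLTerm X} : Le a c → Le b c → Le (sup a b) c
  | distrib (a b c : DLTerm X) : Le (inf (sup a b) (sup a c)) (sup a (inf b c))

instance (X : Type u) : Preorder (DLTerm X) where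
  le := Le
  le_refl := Le.refl
  le_trans _ _ _ := Le.trans

/-- The value of a term in a bounded distributive lattice under an assignment of the variables. -/
def eval {X : Type u} {D : Type w} [DistribLattice D] [BoundedOrder D] (f : X → D) :
    DLTerm X → D
  | var x => f x
  | bot => ⊥
  | top => ⊤
  | inf s t => eval f s ⊓ eval f t
  | sup s t => eval f s ⊔ eval f t

theorem eval_mono {X : Type u} {D : Type w} [DistribLattice D] [BoundedOrder D] (f : X → D) :
    Monotone (eval f) := by
  intro s t h
  change Le s t at h
  induction h with
  | refl a => exact le_rfl
  | trans _ _ h₁ h₂ => exact h₁.trans h₂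
  | bot_le a => exact _root_.bot_le
  | le_top a => exact _root_.le_top
  | inf_le_left a b => exact _root_.inf_le_left
  | inf_le_right a b => exact _root_.inf_le_right
  | le_inf _ _ h₁ h₂ => exact _root_.le_inf h₁ h₂
  | le_sup_left a b => exact _root_.le_sup_left
  | le_sup_right a b => exact _root_.le_sup_right
  | sup_le _ _ h₁ h₂ => exact _root_.sup_le h₁ h₂
  | distrib a b c => exact _root_.le_sup_inf

end DLTerm

/-- The free bounded distributive lattice on `X`: terms modulo provable equality, where two terms
are identified when each is provably below the other. -/
def FreeDL (X : Type u) : Type u := Antisymmetrization (DLTerm X) (· ≤ ·)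

namespace FreeDL

/-- The class of a term. -/
def mk {X : Type u} (t : DLTerm X) : FreeDL X := toAntisymmetrization (· ≤ ·) t

/-- The generator belonging to `x`. -/
def of {X : Type u} (x : X) : FreeDL X := mk (DLTerm.var x)

instance (X : Type u) : PartialOrder (FreeDL X) :=
  inferInstanceAs (PartialOrder (Antisymmetrization (DLTerm X) (· ≤ ·)))

theorem ind {X : Type u} {p : FreeDL X → Prop} (h : ∀ t, p (mk t)) (a : FreeDL X) : p a :=
  Quotient.inductionOn' a h

theorem mk_le_mk {X : Type u} {s t : DLTerm X} : mk s ≤ mk t ↔ DLTerm.Le s t := Iff.rfl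

instance (X : Type u) : DistribLattice (FreeDL X) where
  inf := Quotient.map₂ DLTerm.inf fun _ _ h _ _ h' =>
    ⟨.le_inf (.trans (.inf_le_left _ _) h.1) (.trans (.inf_le_right _ _) h'.1),
      .le_inf (.trans (.inf_le_left _ _) h.2) (.trans (.inf_le_right _ _) h'.2)⟩
  sup := Quotient.map₂ DLTerm.sup fun _ _ h _ _ h' =>
    ⟨.sup_le (.trans h.1 (.le_sup_left _ _)) (.trans h'.1 (.le_sup_right _ _)),
      .sup_le (.trans h.2 (.le_sup_left _ _)) (.trans h'.2 (.le_sup_right _ _))⟩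
  inf_le_left a b := by
    induction a using ind; induction b using ind
    exact DLTerm.Le.inf_le_left _ _
  inf_le_right a b := by
    induction a using ind; induction b using ind
    exact DLTerm.Le.inf_le_right _ _
  le_inf a b c := by
    induction a using ind; induction b using ind; induction c using ind
    exact DLTerm.Le.le_inf
  le_sup_left a b := by
    induction a using ind; induction b using ind
    exact DLTerm.Le.le_sup_left _ _
  le_sup_right a b := by
    induction a using ind; induction b using ind
    exact DLTerm.Le.le_sup_right _ _
  sup_le a b c := by
    induction a using ind; induction b using ind; induction c using ind
    exact DLTerm.Le.sup_le
  le_sup_inf a b c := by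
    induction a using ind; induction b using ind; induction c using ind
    exact DLTerm.Le.distrib _ _ _

instance (X : Type u) : BoundedOrder (FreeDL X) where
  bot := mk .bot
  top := mk .top
  bot_le a := by
    induction a using ind
    exact DLTerm.Le.bot_le _
  le_top a := by
    induction a using ind
    exact DLTerm.Le.le_top _

/-- The homomorphism out of the free bounded distributive lattice that extends a given assignment
of the generators: `lift f t` is the value `t(f)` of the lattice polynomial `t` at `f`. -/
def lift {X : Type u} {D : Type w} [DistribLattice D] [BoundedOrder D] (f : X → D) :
    BoundedLatticeHom (FreeDL X) D where
  toFun := Quotient.lift (DLTerm.eval f) fun _ _ h =>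
    le_antisymm (DLTerm.eval_mono f h.1) (DLTerm.eval_mono f h.2)
  map_sup' a b := by
    induction a using ind; induction b using ind
    rfl
  map_inf' a b := by
    induction a using ind; induction b using ind
    rfl
  map_top' := rfl
  map_bot' := rfl

@[simp] theorem lift_of {X : Type u} {D : Type w} [DistribLattice D] [BoundedOrder D]
    (f : X → D) (x : X) : lift f (of x) = f x := rfl

/-- Homomorphisms out of a free bounded distributive lattice agree if they agree on generators. -/
theorem hom_ext {X : Type u} {D : Type w} [DistribLattice D] [BoundedOrder D]
    {g h : BoundedLatticeHom (FreeDL X) D} (H : ∀ x, g (of x) = h (of x)) : g = h := by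
  ext a
  induction a using ind with
  | _ t =>
    induction t with
    | var x => exact H x
    | bot => exact (map_bot g).trans (map_bot h).symm
    | top => exact (map_top g).trans (map_top h).symm
    | inf s t hs ht =>
      exact (map_inf g (mk s) (mk t)).trans ((congrArg₂ _ hs ht).trans (map_inf h _ _).symm)
    | sup s t hs ht =>
      exact (map_sup g (mk s) (mk t)).trans ((congrArg₂ _ hs ht).trans (map_sup h _ _).symm)

theorem lift_of_id {X : Type u} (a : FreeDL X) : lift of a = a :=
  DFunLike.congr_fun (hom_ext (g := lift of) (h := BoundedLatticeHom.id _) fun _ => rfl) a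

/-- A homomorphism commutes with the evaluation of lattice polynomials. -/
theorem map_lift {X : Type u} {D : Type w} {E : Type v} [DistribLattice D] [BoundedOrder D]
    [DistribLattice E] [BoundedOrder E] (g : BoundedLatticeHom D E) (f : X → D) (a : FreeDL X) :
    g (lift f a) = lift (fun x => g (f x)) a :=
  DFunLike.congr_fun (hom_ext (g := g.comp (lift f)) (h := lift fun x => g (f x)) fun _ => rfl) a

end FreeDL

/-! ### The cube category and cubical sets -/

/-- The objects of the cube category: the `n`-dimensional cubes, for `n : ℕ`. -/
structure Cube : Type where
  /-- The dimension. -/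
  dim : ℕ

/-- The cube category, in the orientation in which a cube of dimension `n` is the `n`-th power of
the interval: a morphism `m ⟶ n` is an `n`-tuple of lattice polynomials in `m` variables, and
composition is substitution. It is the opposite of the category of free finitely generated bounded
distributive lattices, presented through the Kleisli category of the free-lattice monad. -/
instance : Category Cube where
  Hom m n := Fin n.dim → FreeDL (Fin m.dim)
  id _ := FreeDL.of
  comp f g := fun i => FreeDL.lift f (g i)
  id_comp f := funext fun i => FreeDL.lift_of_id (f i)
  comp_id _ := rfl
  assoc f g h := funext fun i => (FreeDL.map_lift (FreeDL.lift f) g (h i)).symm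

/-- Cubical sets: presheaves of sets on the cube category. -/
abbrev CubicalSet : Type 1 := Cubeᵒᵖ ⥤ Type

/-! ### Flat distributive lattices -/

/-- The functor `n ↦ D ^ n` on the cube category defined by a bounded distributive lattice `D`:
a tuple of lattice polynomials acts by evaluation. -/
def cubePowers (D : Type w) [DistribLattice D] [BoundedOrder D] : Cube ⥤ Type w where
  obj n := Fin n.dim → D
  map φ := TypeCat.ofHom fun d i => FreeDL.lift d (φ i)
  map_id _ := rfl
  map_comp φ ψ := by
    ext d i
    exact FreeDL.map_lift (FreeDL.lift d) φ (ψ i)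

/-- A bounded distributive lattice `D` (in sets) is flat if the functor `n ↦ D ^ n` is filtering:
its category of elements is cofiltered, that is, it is nonempty, any two elements `y ∈ D ^ c`,
`z ∈ D ^ d` are images of one element of some `D ^ b`, and whenever two parallel morphisms `α, β` of
cubes agree on `y ∈ D ^ c`, there are a `γ` with `γ ≫ α = γ ≫ β` and a `z` with `γ z = y`. -/
def IsFlatLattice (D : Type w) [DistribLattice D] [BoundedOrder D] : Prop :=
  IsCofiltered (cubePowers D).Elements

/-- The functor `n ↦ L ^ n` from the cube category to presheaves defined by a presheaf `L` of bounded
distributive lattices (that is, by a distributive lattice in the topos, if `L` is a sheaf). -/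
def cubePowersPresheaf {C : Type u} [Category.{v} C] (L : Cᵒᵖ ⥤ BddDistLat.{w}) :
    Cube ⥤ Cᵒᵖ ⥤ Type w where
  obj n :=
    { obj U := Fin n.dim → L.obj U
      map f := TypeCat.ofHom fun d i => L.map f (d i)
      map_id U := by ext d i; exact ConcreteCategory.congr_hom (L.map_id U) (d i)
      map_comp f g := by ext d i; exact ConcreteCategory.congr_hom (L.map_comp f g) (d i) }
  map φ :=
    { app U := TypeCat.ofHom fun d i => FreeDL.lift d (φ i)
      naturality U V f := by
        ext d i
        exact (FreeDL.map_lift (L.map f).hom d (φ i)).symm }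
  map_id _ := rfl
  map_comp φ ψ := by
    ext U d i
    exact FreeDL.map_lift (FreeDL.lift d) φ (ψ i)

/-- A functor from `A` to a topos of sheaves is filtering, in the internal sense: the three
conditions hold locally, after restriction along a covering sieve. -/
structure IsFilteringFunctor {A : Type*} [Category A] {C : Type u} [Category.{v} C]
    (J : GrothendieckTopology C) (F : A ⥤ Cᵒᵖ ⥤ Type w) : Prop where
  inhabited : ∀ U : C, ∃ S ∈ J U, ∀ ⦃V : C⦄ (f : V ⟶ U), S f →
    ∃ a : A, Nonempty ((F.obj a).obj (op V))
  transitivity : ∀ (U : C) (c d : A) (y : (F.obj c).obj (op U)) (z : (F.obj d).obj (op U)),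
    ∃ S ∈ J U, ∀ ⦃V : C⦄ (f : V ⟶ U), S f →
      ∃ (b : A) (α : b ⟶ c) (β : b ⟶ d) (x : (F.obj b).obj (op V)),
        (F.map α).app (op V) x = (F.obj c).map f.op y ∧
        (F.map β).app (op V) x = (F.obj d).map f.op z
  freeness : ∀ (U : C) (c d : A) (α β : c ⟶ d) (y : (F.obj c).obj (op U)),
    (F.map α).app (op U) y = (F.map β).app (op U) y →
    ∃ S ∈ J U, ∀ ⦃V : C⦄ (f : V ⟶ U), S f →
      ∃ (b : A) (γ : b ⟶ c) (z : (F.obj b).obj (op V)),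
        γ ≫ α = γ ≫ β ∧ (F.map γ).app (op V) z = (F.obj c).map f.op y

/-- `L` is a flat distributive lattice in the topos of sheaves on `(C, J)`. -/
structure IsFlatLatticeIn {C : Type u} [Category.{v} C] (J : GrothendieckTopology C)
    (L : Cᵒᵖ ⥤ BddDistLat.{w}) : Prop where
  isSheaf : Presheaf.IsSheaf J (L ⋙ forget BddDistLat)
  filtering : IsFilteringFunctor J (cubePowersPresheaf L)

/-! ### Linear orders in a topos -/

/-- `P` is a linear order with distinct endpoints in the topos of sheaves on `(C, J)`: a sheaf of
bounded posets whose order relation is a subsheaf of `P × P`, which satisfies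
`x ≤ y ∨ y ≤ x` in the internal sense (locally), and in which `⊥ = ⊤` is internally false (it holds
only over objects that are covered by the empty sieve). -/
structure IsLinearOrderIn {C : Type u} [Category.{v} C] (J : GrothendieckTopology C)
    (P : Cᵒᵖ ⥤ BddOrd.{w}) : Prop where
  isSheaf : Presheaf.IsSheaf J (P ⋙ forget BddOrd)
  le_of_locally : ∀ (U : C) (x y : P.obj (op U)), ∀ S ∈ J U,
    (∀ ⦃V : C⦄ (f : V ⟶ U), S f → P.map f.op x ≤ P.map f.op y) → x ≤ y
  total : ∀ (U : C) (x y : P.obj (op U)), ∃ S ∈ J U, ∀ ⦃V : C⦄ (f : V ⟶ U), S f →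
    P.map f.op x ≤ P.map f.op y ∨ P.map f.op y ≤ P.map f.op x
  bot_ne_top : ∀ U : C, (⊥ : P.obj (op U)) = ⊤ → (⊥ : Sieve U) ∈ J U

/-- The underlying bounded poset of a bounded distributive lattice. -/
abbrev bddDistLatToBddOrd : BddDistLat.{w} ⥤ BddOrd.{w} :=
  forget₂ BddDistLat BddLat ⋙ forget₂ BddLat BddOrd

/-! ### The interval in simplicial sets -/

instance (n : ℕ) : DistribLattice (Fin n →o Fin 2) where
  le_sup_inf a b c i := le_sup_inf (x := a i) (y := b i) (z := c i)

/-- The simplicial set `Δ[1]`, whose `n`-simplices are the monotone maps `[n] → [1]`, with the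
pointwise order and lattice operations. -/
def simplexInterval : SimplexCategoryᵒᵖ ⥤ BddDistLat.{0} where
  obj n := BddDistLat.of (Fin (n.unop.len + 1) →o Fin 2)
  map f := BddDistLat.ofHom
    { toFun x := x.comp f.unop.toOrderHom
      map_sup' _ _ := rfl
      map_inf' _ _ := rfl
      map_top' := rfl
      map_bot' := rfl }
  map_id _ := rfl
  map_comp _ _ := rfl

/-! ### Geometric morphisms -/

/-- A geometric morphism `E ⟶ F`: an adjunction `inverseImage ⊣ directImage` whose left adjoint
preserves finite limits. -/
structure GeometricMorphism (E : Type*) [Category E] (F : Type*) [Category F] where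
  /-- The direct image. -/
  directImage : E ⥤ F
  /-- The inverse image. -/
  inverseImage : F ⥤ E
  /-- The inverse image is left adjoint to the direct image. -/
  adj : inverseImage ⊣ directImage
  /-- The inverse image is left exact. -/
  preservesFiniteLimits : Limits.PreservesFiniteLimits inverseImage

end

/-!
The heart of the matter is the freeness condition at a finite chain. Let `y` be a finite family in a
bounded distributive lattice `D` with `⊥ ≠ ⊤` whose members are pairwise comparable. With the
endpoints adjoined it is a finite chain, and a finite chain with distinct endpoints is a retract of
a free distributive lattice: `chainSection y` sends `e` to the join of the variables `i` with
`⊥ ≠ y i ≤ e` (and `⊤` to `⊤`), it is a homomorphism on the chain because it is monotone, and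
evaluation at `y` takes it back. Substituting `chainSection y (y i)` for the variable `i` thus fixes
`y` and turns every lattice polynomial into one that depends only on its value at `y`
(`lift_chainSection_comp`), so that it equalizes all pairs of polynomials that agree at `y`
(`exists_equalizing_of_chain`). The other two conditions of flatness come from the cube of
dimension zero and from products of cubes.

In a topos of sheaves the maxima and minima exist locally, where two sections are comparable, and
glue because they are unique (`IsLinearOrderIn.exists_of_cases`); the lattice laws are checked
locally. For flatness, pass to a cover on which the members of `y` are pairwise comparable. Equality
of sections need not be locally decidable, but the argument about chains is applied to the lattice
of sections over a single object, where it may be decided classically; if `⊥ = ⊤` over that object,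
then the empty sieve covers it.

For simplicial sets the inverse image is the left Kan extension of `n ↦ Δ[1] ^ n` along the Yoneda
embedding. Finite limits of presheaves are computed pointwise. At the object `[n]`, the functor is
the cocontinuous extension of the powers of the totally ordered set of monotone maps `[n] → [1]`.
These powers have a cofiltered category of elements, that is, they form a point of the cube category
with the trivial topology, and the fibre functor of a point is left exact
(`preservesFiniteLimits_of_isCofiltered_elements`).
-/

/-! ### Chains in a distributive lattice -/

theorem Monotone.map_inf_of_le_or_le {α β : Type*} [Lattice α] [Lattice β] {f : α → β}
    (hf : Monotone f) {a b : α} (h : a ≤ b ∨ b ≤ a) : f (a ⊓ b) = f a ⊓ f b := by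
  rcases h with h | h
  · rw [inf_eq_left.2 h, inf_eq_left.2 (hf h)]
  · rw [inf_eq_right.2 h, inf_eq_right.2 (hf h)]

theorem Monotone.map_sup_of_le_or_le {α β : Type*} [Lattice α] [Lattice β] {f : α → β}
    (hf : Monotone f) {a b : α} (h : a ≤ b ∨ b ≤ a) : f (a ⊔ b) = f a ⊔ f b :=
  hf.dual.map_inf_of_le_or_le h.symm

/-- The values of lattice polynomials at a chain lie in the chain, up to the endpoints. -/
theorem FreeDL.lift_mem_of_chain {D : Type w} [DistribLattice D] [BoundedOrder D] {ι : Type u}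
    (y : ι → D) (hy : ∀ i j, y i ≤ y j ∨ y j ≤ y i) (a : FreeDL ι) :
    FreeDL.lift y a = ⊥ ∨ FreeDL.lift y a = ⊤ ∨ ∃ i, FreeDL.lift y a = y i := by
  induction a using FreeDL.ind with
  | _ t =>
    induction t with
    | var x => exact Or.inr (Or.inr ⟨x, rfl⟩)
    | bot => exact Or.inl rfl
    | top => exact Or.inr (Or.inl rfl)
    | inf s t hs ht =>
      have e : FreeDL.lift y (.mk (.inf s t)) = FreeDL.lift y (.mk s) ⊓ FreeDL.lift y (.mk t) := rfl
      rcases hs with hs | hs | ⟨i, hs⟩ <;> rcases ht with ht | ht | ⟨j, ht⟩ <;>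
        rw [e, hs, ht] <;> try simp
      rcases hy i j with h | h
      · exact Or.inr (Or.inr ⟨i, inf_eq_left.2 h⟩)
      · exact Or.inr (Or.inr ⟨j, inf_eq_right.2 h⟩)
    | sup s t hs ht =>
      have e : FreeDL.lift y (.mk (.sup s t)) = FreeDL.lift y (.mk s) ⊔ FreeDL.lift y (.mk t) := rfl
      rcases hs with hs | hs | ⟨i, hs⟩ <;> rcases ht with ht | ht | ⟨j, ht⟩ <;>
        rw [e, hs, ht] <;> try simp
      rcases hy i j with h | h
      · exact Or.inr (Or.inr ⟨j, sup_eq_right.2 h⟩)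
      · exact Or.inr (Or.inr ⟨i, sup_eq_left.2 h⟩)

/-- Any two values of lattice polynomials at a chain are comparable. -/
theorem FreeDL.lift_le_or_le_of_chain {D : Type w} [DistribLattice D] [BoundedOrder D]
    {ι : Type u} (y : ι → D) (hy : ∀ i j, y i ≤ y j ∨ y j ≤ y i) (a b : FreeDL ι) :
    FreeDL.lift y a ≤ FreeDL.lift y b ∨ FreeDL.lift y b ≤ FreeDL.lift y a := by
  rcases lift_mem_of_chain y hy a with ha | ha | ⟨i, ha⟩ <;>
    rcases lift_mem_of_chain y hy b with hb | hb | ⟨j, hb⟩ <;> rw [ha, hb] <;> try simp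
  exact hy i j

section ChainSection

variable {D : Type w} [DistribLattice D] [BoundedOrder D] {ι : Type u} [Fintype ι]

open Classical in
/-- For a finite family `y` in `D`, the map `D → FreeDL ι` that sends `e` to the join of the
variables `i` with `⊥ ≠ y i ≤ e`, except that `⊤` is sent to `⊤`. If the members of `y` form a
chain, then on this chain with the endpoints adjoined it is a section of the evaluation
`FreeDL.lift y` and a homomorphism of bounded lattices. -/
noncomputable def chainSection (y : ι → D) (e : D) : FreeDL ι :=
  if e = ⊤ then ⊤ else (Finset.univ.filter fun i => y i ≤ e ∧ y i ≠ ⊥).sup FreeDL.of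

theorem chainSection_top (y : ι → D) : chainSection y ⊤ = ⊤ := if_pos rfl

theorem chainSection_bot (h : (⊥ : D) ≠ ⊤) (y : ι → D) : chainSection y ⊥ = ⊥ := by
  classical
  rw [chainSection, if_neg h, Finset.sup_eq_bot_iff]
  intro i hi
  exact absurd (le_bot_iff.1 (Finset.mem_filter.1 hi).2.1) (Finset.mem_filter.1 hi).2.2

theorem chainSection_mono (y : ι → D) : Monotone (chainSection y) := by
  intro e e' h
  by_cases h' : e' = ⊤
  · subst h'
    rw [chainSection_top]
    exact le_top
  · rw [chainSection, chainSection, if_neg h', if_neg (ne_top_of_le_ne_top h' h)]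
    exact Finset.sup_mono fun i hi => by
      simp only [Finset.mem_filter, Finset.mem_univ, true_and] at hi ⊢
      exact ⟨hi.1.trans h, hi.2⟩

theorem lift_chainSection (y : ι → D) (i : ι) :
    FreeDL.lift y (chainSection y (y i)) = y i := by
  classical
  by_cases h : y i = ⊤
  · rw [h, chainSection_top, map_top]
  · rw [chainSection, if_neg h, map_finset_sup]
    refine le_antisymm (Finset.sup_le fun j hj => (Finset.mem_filter.1 hj).2.1) ?_
    by_cases hi : y i = ⊥
    · rw [hi]
      exact bot_le
    · exact Finset.le_sup (f := FreeDL.lift y ∘ FreeDL.of)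
        (Finset.mem_filter.2 ⟨Finset.mem_univ i, le_rfl, hi⟩)

/-- Substituting the section for the variables of a lattice polynomial `a` gives a polynomial that
depends only on the value of `a` at the chain `y`. -/
theorem lift_chainSection_comp (h : (⊥ : D) ≠ ⊤) (y : ι → D)
    (hy : ∀ i j, y i ≤ y j ∨ y j ≤ y i) (a : FreeDL ι) :
    FreeDL.lift (fun i => chainSection y (y i)) a = chainSection y (FreeDL.lift y a) := by
  induction a using FreeDL.ind with
  | _ t =>
    induction t with
    | var x => rfl
    | bot => exact (chainSection_bot h y).symm
    | top => exact (chainSection_top y).symm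
    | inf s t hs ht =>
      exact (congrArg₂ (· ⊓ ·) hs ht).trans ((chainSection_mono y).map_inf_of_le_or_le
        (FreeDL.lift_le_or_le_of_chain y hy (.mk s) (.mk t))).symm
    | sup s t hs ht =>
      exact (congrArg₂ (· ⊔ ·) hs ht).trans ((chainSection_mono y).map_sup_of_le_or_le
        (FreeDL.lift_le_or_le_of_chain y hy (.mk s) (.mk t))).symm

end ChainSection

/-- The freeness condition at a chain: two tuples of lattice polynomials that agree at a chain `y`
are equalized by a substitution `γ` that fixes `y`. The substitution is the retraction of the free
lattice onto the chain generated by `y`. -/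
theorem exists_equalizing_of_chain {D : Type w} [DistribLattice D] [BoundedOrder D]
    (h : (⊥ : D) ≠ ⊤) {c d : Cube} (α β : c ⟶ d) (y : Fin c.dim → D)
    (hy : ∀ i j, y i ≤ y j ∨ y j ≤ y i)
    (hαβ : ∀ i, FreeDL.lift y (α i) = FreeDL.lift y (β i)) :
    ∃ γ : c ⟶ c, γ ≫ α = γ ≫ β ∧ ∀ i, FreeDL.lift y (γ i) = y i := by
  refine ⟨fun i => chainSection y (y i), funext fun i => ?_, lift_chainSection y⟩
  change FreeDL.lift _ (α i) = FreeDL.lift _ (β i)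
  rw [lift_chainSection_comp h y hy, lift_chainSection_comp h y hy, hαβ]

/-! ### Products of cubes -/

namespace Cube

/-- The product of two cubes. -/
def prod (c d : Cube) : Cube := ⟨c.dim + d.dim⟩

/-- The first projection. -/
def fst (c d : Cube) : prod c d ⟶ c := fun i => FreeDL.of (Fin.castAdd d.dim i)

/-- The second projection. -/
def snd (c d : Cube) : prod c d ⟶ d := fun i => FreeDL.of (Fin.natAdd c.dim i)

end Cube

/-! ### Linearly ordered sets -/

theorem isFlatLattice_of_le_total {D : Type w} [DistribLattice D] [BoundedOrder D]
    (htotal : ∀ x y : D, x ≤ y ∨ y ≤ x) (h : (⊥ : D) ≠ ⊤) : IsFlatLattice D where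
  nonempty := ⟨⟨⟨0⟩, Fin.elim0⟩⟩
  cone_objs y z :=
    ⟨⟨Cube.prod y.1 z.1, Fin.append y.2 z.2⟩,
      ⟨Cube.fst y.1 z.1, funext fun i => Fin.append_left y.2 z.2 i⟩,
      ⟨Cube.snd y.1 z.1, funext fun i => Fin.append_right y.2 z.2 i⟩, trivial⟩
  cone_maps y z α β := by
    obtain ⟨γ, hγ, hγy⟩ := exists_equalizing_of_chain h α.1 β.1 y.2 (fun _ _ => htotal _ _)
      fun i => (congrFun α.2 i).trans (congrFun β.2 i).symm
    exact ⟨y, ⟨γ, funext hγy⟩, Subtype.ext hγ⟩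

/-! ### Flatness in a topos of sheaves -/

theorem CategoryTheory.GrothendieckTopology.finset_inf_mem {C : Type u} [Category.{v} C]
    (J : GrothendieckTopology C) {U : C} {ι : Type*} (s : Finset ι) (S : ι → Sieve U)
    (hS : ∀ i ∈ s, S i ∈ J U) : s.inf S ∈ J U :=
  Finset.inf_induction (J.top_mem U) (fun _ h₁ _ h₂ => J.intersection_covering h₁ h₂) hS

theorem BddOrd.presheaf_map_comp_apply {C : Type u} [Category.{v} C] (P : Cᵒᵖ ⥤ BddOrd.{w})
    {U V W : C} (f : V ⟶ U) (g : W ⟶ V) (x : P.obj (op U)) :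
    P.map (g ≫ f).op x = P.map g.op (P.map f.op x) :=
  ConcreteCategory.congr_hom (P.map_comp f.op g.op) x

/-- The sieve of all arrows along which the restrictions of `x` and `y` are comparable. -/
def comparableSieve {C : Type u} [Category.{v} C] (P : Cᵒᵖ ⥤ BddOrd.{w}) {U : C}
    (x y : P.obj (op U)) : Sieve U where
  arrows _ f := P.map f.op x ≤ P.map f.op y ∨ P.map f.op y ≤ P.map f.op x
  downward_closed := by
    intro V W f h g
    rw [BddOrd.presheaf_map_comp_apply, BddOrd.presheaf_map_comp_apply]
    exact h.imp (fun h => OrderHomClass.mono (P.map g.op).hom h)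
      (fun h => OrderHomClass.mono (P.map g.op).hom h)

theorem IsLinearOrderIn.comparableSieve_mem {C : Type u} [Category.{v} C]
    {J : GrothendieckTopology C} {P : Cᵒᵖ ⥤ BddOrd.{w}} (h : IsLinearOrderIn J P) {U : C}
    (x y : P.obj (op U)) : comparableSieve P x y ∈ J U := by
  obtain ⟨S, hS, hS'⟩ := h.total U x y
  exact J.superset_covering (fun V f hf => hS' f hf) hS

/-- The sieve of all arrows to `U` along which the freeness condition for `α`, `β` and `y` has a
solution. -/
def equalizingSieve {C : Type u} [Category.{v} C] (L : Cᵒᵖ ⥤ BddDistLat.{w}) {c d : Cube}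
    (α β : c ⟶ d) {U : C} (y : ((cubePowersPresheaf L).obj c).obj (op U)) : Sieve U where
  arrows V f := ∃ (b : Cube) (γ : b ⟶ c) (z : ((cubePowersPresheaf L).obj b).obj (op V)),
    γ ≫ α = γ ≫ β ∧ ((cubePowersPresheaf L).map γ).app (op V) z =
      ((cubePowersPresheaf L).obj c).map f.op y
  downward_closed := by
    rintro V W f ⟨b, γ, z, hγ, hz⟩ g
    refine ⟨b, γ, ((cubePowersPresheaf L).obj b).map g.op z, hγ, ?_⟩
    rw [op_comp, Functor.map_comp_apply, ← hz, NatTrans.naturality_apply]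

/-- A sheaf of bounded distributive lattices that is locally totally ordered and nondegenerate is
flat. -/
theorem isFlatLatticeIn_of_isLinearOrderIn {C : Type u} [Category.{v} C]
    {J : GrothendieckTopology C} {L : Cᵒᵖ ⥤ BddDistLat.{w}}
    (h : IsLinearOrderIn J (L ⋙ bddDistLatToBddOrd)) : IsFlatLatticeIn J L where
  isSheaf := h.isSheaf
  filtering :=
    { inhabited U := ⟨⊤, J.top_mem U, fun V _ _ => ⟨⟨0⟩, ⟨Fin.elim0⟩⟩⟩
      transitivity U c d y z := by
        refine ⟨⊤, J.top_mem U, fun V f _ => ⟨Cube.prod c d, Cube.fst c d, Cube.snd c d,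
          ((cubePowersPresheaf L).obj (Cube.prod c d)).map f.op (Fin.append y z), ?_, ?_⟩⟩
        · exact funext fun i => congrArg (L.map f.op) (Fin.append_left y z i)
        · exact funext fun i => congrArg (L.map f.op) (Fin.append_right y z i)
      freeness U c d α β y hy := by
        refine ⟨equalizingSieve L α β y, ?_, fun V f hf => hf⟩
        refine J.transitive (J.finset_inf_mem Finset.univ
          (fun p : Fin c.dim × Fin c.dim =>
            comparableSieve (L ⋙ bddDistLatToBddOrd) (y p.1) (y p.2))
          fun p _ => h.comparableSieve_mem _ _) _ fun V f hf => ?_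
        by_cases hV : (⊥ : L.obj (op V)) = ⊤
        · -- over `V` the lattice is trivial, so that the empty sieve covers `V`
          exact J.superset_covering bot_le (h.bot_ne_top V hV)
        · have hchain (i j : Fin c.dim) : L.map f.op (y i) ≤ L.map f.op (y j) ∨
              L.map f.op (y j) ≤ L.map f.op (y i) :=
            Finset.inf_le (f := fun p : Fin c.dim × Fin c.dim =>
              comparableSieve (L ⋙ bddDistLatToBddOrd) (y p.1) (y p.2))
              (Finset.mem_univ (i, j)) f hf
          obtain ⟨γ, hγ, hγy⟩ := exists_equalizing_of_chain hV α β
            (fun i => L.map f.op (y i)) hchain fun i =>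
              (FreeDL.map_lift (L.map f.op).hom y (α i)).symm.trans
                ((congrArg (L.map f.op) (congrFun hy i)).trans
                  (FreeDL.map_lift (L.map f.op).hom y (β i)))
          refine J.superset_covering ?_ (J.top_mem V)
          refine (Sieve.mem_iff_pullback_eq_top f).1 ?_ |>.ge
          exact ⟨c, γ, _, hγ, funext hγy⟩ }

/-! ### The lattice operations of a linear order in a topos -/

namespace IsLinearOrderIn

variable {C : Type u} [Category.{v} C] {J : GrothendieckTopology C} {P : Cᵒᵖ ⥤ BddOrd.{w}}

theorem eq_of_locally (h : IsLinearOrderIn J P) {U : C} {x y : P.obj (op U)} {S : Sieve U}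
    (hS : S ∈ J U) (hxy : ∀ ⦃V : C⦄ (f : V ⟶ U), S f → P.map f.op x = P.map f.op y) : x = y :=
  le_antisymm (h.le_of_locally U x y S hS fun _ f hf => (hxy f hf).le)
    (h.le_of_locally U y x S hS fun _ f hf => (hxy f hf).ge)

/-- Definition by cases along a linear order: a section that is `a` where `x ≤ y` and `b` where
`y ≤ x` exists if `a` and `b` agree where `x = y`. -/
theorem exists_of_cases (h : IsLinearOrderIn J P) {U : C} (x y a b : P.obj (op U))
    (hab : ∀ ⦃V : C⦄ (f : V ⟶ U), P.map f.op x = P.map f.op y → P.map f.op a = P.map f.op b) :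
    ∃ z : P.obj (op U), ∀ ⦃V : C⦄ (f : V ⟶ U),
      (P.map f.op x ≤ P.map f.op y → P.map f.op z = P.map f.op a) ∧
        (P.map f.op y ≤ P.map f.op x → P.map f.op z = P.map f.op b) := by
  classical
  have hP : Presieve.IsSheaf J (P ⋙ forget BddOrd) := (isSheaf_iff_isSheaf_of_type J _).1 h.isSheaf
  let m : Presieve.FamilyOfElements (P ⋙ forget BddOrd) (comparableSieve P x y).arrows :=
    fun V f _ => if P.map f.op x ≤ P.map f.op y then P.map f.op a else P.map f.op b
  have hm_left ⦃V : C⦄ (f : V ⟶ U) (hf) (hxy : P.map f.op x ≤ P.map f.op y) :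
      m f hf = P.map f.op a := if_pos hxy
  have hm_right ⦃V : C⦄ (f : V ⟶ U) (hf) (hyx : P.map f.op y ≤ P.map f.op x) :
      m f hf = P.map f.op b := by
    by_cases hxy : P.map f.op x ≤ P.map f.op y
    · exact (if_pos hxy).trans (hab f (le_antisymm hxy hyx))
    · exact if_neg hxy
  have hm : m.Compatible := by
    rw [Presieve.compatible_iff_sieveCompatible]
    intro V W f g hf
    rcases id hf with hxy | hyx
    · refine (hm_left (g ≫ f) (Sieve.downward_closed _ hf g) ?_).trans ?_
      · rw [BddOrd.presheaf_map_comp_apply, BddOrd.presheaf_map_comp_apply]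
        exact OrderHomClass.mono (P.map g.op).hom hxy
      · exact (BddOrd.presheaf_map_comp_apply P f g a).trans
          (congrArg (P.map g.op) (hm_left f hf hxy).symm)
    · refine (hm_right (g ≫ f) (Sieve.downward_closed _ hf g) ?_).trans ?_
      · rw [BddOrd.presheaf_map_comp_apply, BddOrd.presheaf_map_comp_apply]
        exact OrderHomClass.mono (P.map g.op).hom hyx
      · exact (BddOrd.presheaf_map_comp_apply P f g b).trans
          (congrArg (P.map g.op) (hm_right f hf hyx).symm)
  obtain ⟨z, hz, -⟩ := hP _ (h.comparableSieve_mem x y) m hm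
  exact ⟨z, fun V f => ⟨fun hxy => (hz f (Or.inl hxy)).trans (hm_left f (Or.inl hxy) hxy),
    fun hyx => (hz f (Or.inr hyx)).trans (hm_right f (Or.inr hyx) hyx)⟩⟩

theorem exists_sup (h : IsLinearOrderIn J P) {U : C} (x y : P.obj (op U)) :
    ∃ z : P.obj (op U), ∀ ⦃V : C⦄ (f : V ⟶ U),
      (P.map f.op x ≤ P.map f.op y → P.map f.op z = P.map f.op y) ∧
        (P.map f.op y ≤ P.map f.op x → P.map f.op z = P.map f.op x) :=
  h.exists_of_cases x y y x fun _ _ => Eq.symm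

theorem exists_inf (h : IsLinearOrderIn J P) {U : C} (x y : P.obj (op U)) :
    ∃ z : P.obj (op U), ∀ ⦃V : C⦄ (f : V ⟶ U),
      (P.map f.op x ≤ P.map f.op y → P.map f.op z = P.map f.op x) ∧
        (P.map f.op y ≤ P.map f.op x → P.map f.op z = P.map f.op y) :=
  h.exists_of_cases x y x y fun _ _ => id

/-- The lattice structure on the sections of a linear order: the join is locally the maximum, the
meet is locally the minimum. -/
noncomputable abbrev lattice (h : IsLinearOrderIn J P) (U : C) : Lattice (P.obj (op U)) where
  sup x y := (h.exists_sup x y).choose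
  inf x y := (h.exists_inf x y).choose
  le_sup_left x y := h.le_of_locally U _ _ _ (h.comparableSieve_mem x y) fun V f hf => by
    have hz := (h.exists_sup x y).choose_spec f
    rcases hf with hf | hf
    · exact hf.trans (hz.1 hf).ge
    · exact (hz.2 hf).ge
  le_sup_right x y := h.le_of_locally U _ _ _ (h.comparableSieve_mem x y) fun V f hf => by
    have hz := (h.exists_sup x y).choose_spec f
    rcases hf with hf | hf
    · exact (hz.1 hf).ge
    · exact hf.trans (hz.2 hf).ge
  sup_le x y w hx hy := h.le_of_locally U _ _ _ (h.comparableSieve_mem x y) fun V f hf => by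
    have hz := (h.exists_sup x y).choose_spec f
    rcases hf with hf | hf
    · exact (hz.1 hf).le.trans (OrderHomClass.mono (P.map f.op).hom hy)
    · exact (hz.2 hf).le.trans (OrderHomClass.mono (P.map f.op).hom hx)
  inf_le_left x y := h.le_of_locally U _ _ _ (h.comparableSieve_mem x y) fun V f hf => by
    have hz := (h.exists_inf x y).choose_spec f
    rcases hf with hf | hf
    · exact (hz.1 hf).le
    · exact (hz.2 hf).le.trans hf
  inf_le_right x y := h.le_of_locally U _ _ _ (h.comparableSieve_mem x y) fun V f hf => by
    have hz := (h.exists_inf x y).choose_spec f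
    rcases hf with hf | hf
    · exact (hz.1 hf).le.trans hf
    · exact (hz.2 hf).le
  le_inf w x y hx hy := h.le_of_locally U _ _ _ (h.comparableSieve_mem x y) fun V f hf => by
    have hz := (h.exists_inf x y).choose_spec f
    rcases hf with hf | hf
    · exact (OrderHomClass.mono (P.map f.op).hom hx).trans (hz.1 hf).ge
    · exact (OrderHomClass.mono (P.map f.op).hom hy).trans (hz.2 hf).ge

theorem map_sup (h : IsLinearOrderIn J P) {U V : C} (f : V ⟶ U) (x y : P.obj (op U)) :
    letI := h.lattice U
    letI := h.lattice V
    P.map f.op (x ⊔ y) = P.map f.op x ⊔ P.map f.op y := by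
  refine h.eq_of_locally (h.comparableSieve_mem (P.map f.op x) (P.map f.op y)) fun W g hg => ?_
  have hz := (h.exists_sup x y).choose_spec (g ≫ f)
  have hz' := (h.exists_sup (P.map f.op x) (P.map f.op y)).choose_spec g
  simp only [BddOrd.presheaf_map_comp_apply] at hz
  rcases hg with hg | hg
  · exact (hz.1 hg).trans (hz'.1 hg).symm
  · exact (hz.2 hg).trans (hz'.2 hg).symm

theorem map_inf (h : IsLinearOrderIn J P) {U V : C} (f : V ⟶ U) (x y : P.obj (op U)) :
    letI := h.lattice U
    letI := h.lattice V
    P.map f.op (x ⊓ y) = P.map f.op x ⊓ P.map f.op y := by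
  refine h.eq_of_locally (h.comparableSieve_mem (P.map f.op x) (P.map f.op y)) fun W g hg => ?_
  have hz := (h.exists_inf x y).choose_spec (g ≫ f)
  have hz' := (h.exists_inf (P.map f.op x) (P.map f.op y)).choose_spec g
  simp only [BddOrd.presheaf_map_comp_apply] at hz
  rcases hg with hg | hg
  · exact (hz.1 hg).trans (hz'.1 hg).symm
  · exact (hz.2 hg).trans (hz'.2 hg).symm

/-- The lattice of sections of a linear order is distributive, because it is so locally, where
the two elements whose meet occurs in the distributive law are comparable. -/
noncomputable abbrev distribLattice (h : IsLinearOrderIn J P) (U : C) :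
    DistribLattice (P.obj (op U)) where
  __ := h.lattice U
  le_sup_inf x y z := h.le_of_locally U _ _ _ (h.comparableSieve_mem y z) fun V f hf => by
    let := h.lattice U
    let := h.lattice V
    change P.map f.op ((x ⊔ y) ⊓ (x ⊔ z)) ≤ P.map f.op (x ⊔ y ⊓ z)
    rw [h.map_inf, h.map_sup, h.map_sup, h.map_sup, h.map_inf]
    rcases hf with hf | hf
    · rw [inf_eq_left.2 hf]
      exact inf_le_left
    · rw [inf_eq_right.2 hf]
      exact inf_le_right

/-- The distributive lattice in the topos of sheaves whose underlying ordered object is a given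
linear order. -/
noncomputable def toBddDistLat (h : IsLinearOrderIn J P) : Cᵒᵖ ⥤ BddDistLat.{w} where
  obj U := letI := h.distribLattice U.unop; BddDistLat.of (P.obj U)
  map {U V} f :=
    letI := h.distribLattice U.unop
    letI := h.distribLattice V.unop
    BddDistLat.ofHom
      { toFun := P.map f
        map_sup' := h.map_sup f.unop
        map_inf' := h.map_inf f.unop
        map_top' := (P.map f).hom.map_top'
        map_bot' := (P.map f).hom.map_bot' }
  map_id U := BddDistLat.ext fun x => ConcreteCategory.congr_hom (P.map_id U) x
  map_comp f g := BddDistLat.ext fun x => ConcreteCategory.congr_hom (P.map_comp f g) x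

/-- The underlying ordered object of the lattice is the given linear order. -/
noncomputable def toBddDistLatCompIso (h : IsLinearOrderIn J P) :
    h.toBddDistLat ⋙ bddDistLatToBddOrd ≅ P :=
  NatIso.ofComponents (fun U => Iso.refl (P.obj U)) fun _ => rfl

theorem toBddDistLat_isLinearOrderIn (h : IsLinearOrderIn J P) :
    IsLinearOrderIn J (h.toBddDistLat ⋙ bddDistLatToBddOrd) where
  isSheaf := h.isSheaf
  le_of_locally := h.le_of_locally
  total := h.total
  bot_ne_top := h.bot_ne_top

end IsLinearOrderIn

/-! ### The interval in simplicial sets -/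

/-- The underlying simplicial set of the interval is the standard simplex. -/
noncomputable def simplexIntervalIso : simplexInterval ⋙ forget BddDistLat ≅
    SSet.stdSimplex.{0}.obj (SimplexCategory.mk 1) :=
  NatIso.ofComponents (fun _ => Equiv.toIso
    { toFun x := SSet.stdSimplex.objEquiv.symm (SimplexCategory.Hom.mk x)
      invFun x := (SSet.stdSimplex.objEquiv x).toOrderHom
      left_inv _ := rfl
      right_inv _ := rfl }) fun _ => rfl

/-- Monotone maps to a two-element chain are totally ordered. -/
theorem OrderHom.fin_two_le_total {α : Type*} [LinearOrder α] (x y : α →o Fin 2) :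
    x ≤ y ∨ y ≤ x := by
  by_contra! h
  obtain ⟨h₁, h₂⟩ := h
  rw [OrderHom.le_def, not_forall] at h₁ h₂
  obtain ⟨i, hi⟩ := h₁
  obtain ⟨j, hj⟩ := h₂
  rcases le_total i j with hij | hij
  · have := x.monotone hij
    omega
  · have := y.monotone hij
    omega

theorem simplexInterval_bot_ne_top (n : SimplexCategoryᵒᵖ) :
    (⊥ : simplexInterval.obj n) ≠ ⊤ :=
  fun h => absurd (DFunLike.congr_fun (F := Fin (n.unop.len + 1) →o Fin 2) h 0)
    (by decide : (0 : Fin 2) ≠ 1)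

theorem simplexInterval_isLinearOrderIn :
    IsLinearOrderIn ⊥ (simplexInterval ⋙ bddDistLatToBddOrd) where
  isSheaf := Presheaf.isSheaf_bot _
  le_of_locally U x y S hS h := by
    obtain rfl : S = ⊤ := hS
    exact h (𝟙 U) trivial
  total U x y := ⟨⊤, rfl, fun V f _ => OrderHom.fin_two_le_total _ _⟩
  bot_ne_top U h := absurd h (simplexInterval_bot_ne_top (op U))

/-! ### The geometric morphism -/

open Limits

theorem cubePowers_isCofiltered (n : SimplexCategoryᵒᵖ) :
    IsCofiltered (cubePowers (simplexInterval.obj n)).Elements :=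
  isFlatLattice_of_le_total OrderHom.fin_two_le_total (simplexInterval_bot_ne_top n)

/-- A cocontinuous functor on presheaves whose restriction to representables has a cofiltered
category of elements preserves finite limits: such a restriction is a point of the site with the
trivial topology, and the given functor is the fibre functor of this point. -/
theorem preservesFiniteLimits_of_isCofiltered_elements {C : Type} [SmallCategory C]
    (F : C ⥤ Type) [IsCofiltered F.Elements] (L : (Cᵒᵖ ⥤ Type) ⥤ Type)
    [PreservesColimitsOfSize.{0, 0} L] (e : F ≅ uliftYoneda.{0} ⋙ L) :
    PreservesFiniteLimits L := by
  let Φ : GrothendieckTopology.Point.{0} (⊥ : GrothendieckTopology C) :=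
    { fiber := F
      initiallySmall := initiallySmall_of_essentiallySmall F.Elements
      jointly_surjective := by
        intro X R h x
        obtain rfl : R = ⊤ := h
        exact ⟨X, 𝟙 X, trivial, x, by simp⟩ }
  let e' : F ≅ uliftYoneda.{0} ⋙ Φ.presheafFiber (A := Type) :=
    Φ.shrinkYonedaCompPresheafFiberIso.symm ≪≫
      Functor.isoWhiskerRight uliftYonedaIsoShrinkYoneda.{0}.symm _
  exact preservesFiniteLimits_of_natIso
    (Presheaf.uniqueExtensionAlongULiftYoneda (Φ.presheafFiber (A := Type)) e' ≪≫
      (Presheaf.uniqueExtensionAlongULiftYoneda L e).symm)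

/-- The geometric morphism from simplicial sets to cubical sets that classifies the interval. Its
inverse image is the left Kan extension along the Yoneda embedding of `n ↦ Δ[1] ^ n`. -/
noncomputable def simplicialToCubical : GeometricMorphism SSet.{0} CubicalSet where
  directImage := Presheaf.restrictedULiftYoneda.{0} (cubePowersPresheaf simplexInterval)
  inverseImage := uliftYoneda.{0}.leftKanExtension (cubePowersPresheaf simplexInterval)
  adj := Presheaf.uliftYonedaAdjunction.{0} _
    (uliftYoneda.{0}.leftKanExtensionUnit (cubePowersPresheaf simplexInterval))
  preservesFiniteLimits := by
    refine preservesFiniteLimits_of_evaluation _ fun n => ?_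
    have := cubePowers_isCofiltered n
    have : PreservesColimitsOfSize.{0, 0}
        (uliftYoneda.{0}.leftKanExtension (cubePowersPresheaf simplexInterval)) :=
      Presheaf.preservesColimitsOfSize_leftKanExtension.{0} _
    exact preservesFiniteLimits_of_isCofiltered_elements (cubePowers (simplexInterval.obj n))
      (uliftYoneda.{0}.leftKanExtension (cubePowersPresheaf simplexInterval) ⋙
        (evaluation SimplexCategoryᵒᵖ Type).obj n)
      (Functor.isoWhiskerRight (Presheaf.isExtensionAlongULiftYoneda.{0}
        (cubePowersPresheaf simplexInterval)).symm ((evaluation SimplexCategoryᵒᵖ Type).obj n))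

/-- The inverse image extends `n ↦ Δ[1] ^ n` along the Yoneda embedding. -/
noncomputable def yonedaCompSimplicialToCubicalIso :
    yoneda ⋙ simplicialToCubical.inverseImage ≅ cubePowersPresheaf simplexInterval :=
  Functor.isoWhiskerRight uliftYonedaIsoYoneda.{0}.symm _ ≪≫
    Presheaf.isExtensionAlongULiftYoneda.{0} (cubePowersPresheaf simplexInterval)

theorem mainTheorem5 :
    -- every linear order with distinct endpoints is a flat distributive lattice
    (∀ (D : Type t) [LinearOrder D] [BoundedOrder D], (⊥ : D) ≠ ⊤ → IsFlatLattice D) ∧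
    -- the same in any topos of sheaves
    (∀ (C : Type u) [Category.{v} C] (J : GrothendieckTopology C) (P : Cᵒᵖ ⥤ BddOrd.{w}),
      IsLinearOrderIn J P →
        ∃ L : Cᵒᵖ ⥤ BddDistLat.{w},
          Nonempty (L ⋙ bddDistLatToBddOrd ≅ P) ∧ IsFlatLatticeIn J L) ∧
    -- the interval of simplicial sets is a linear order, and the powers of the associated flat
    -- lattice are the restriction to cubes of the inverse image of a geometric morphism
    Nonempty (simplexInterval ⋙ forget BddDistLat ≅ SSet.stdSimplex.{0}.obj (SimplexCategory.mk 1)) ∧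
    IsLinearOrderIn ⊥ (simplexInterval ⋙ bddDistLatToBddOrd) ∧
    ∃ p : GeometricMorphism SSet.{0} CubicalSet,
      Nonempty (yoneda ⋙ p.inverseImage ≅ cubePowersPresheaf simplexInterval) :=
  ⟨fun _ _ _ h => isFlatLattice_of_le_total le_total h,
    fun _ _ _ _ h => ⟨h.toBddDistLat, ⟨h.toBddDistLatCompIso⟩,
      isFlatLatticeIn_of_isLinearOrderIn h.toBddDistLat_isLinearOrderIn⟩,
    ⟨simplexIntervalIso⟩, simplexInterval_isLinearOrderIn,
    simplicialToCubical, ⟨yonedaCompSimplicialToCubicalIso⟩⟩
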